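/- For $n\ge 1$ let $\mathcal H_{2n-1}=\{x_i-x_j=y_i : 1\le i<j\le n+1\}$ be the homogenized Linial arrangement in $\mathbb R^{2n+1}$ (coordinates $x_1,\dots,x_{n+1},y_1,\dots,y_n$), and let $\mathcal L(\mathcal H_{2n-1})$ be its intersection lattice, i.e. the set of intersections of hyperplanes of $\mathcal H_{2n-1}$ (including the whole space) ordered by reverse inclusion. Let $\Gamma_{2n}$ be the bipartite graph on $\{1,3,\dots,2n-1\}\sqcup\{2,4,\dots,2n\}$ with an edge $\{2i-1,2j\}$ whenever $1\le i\le j\le n$, and let $\Pi_{\Gamma_{2n}}$ be its bond lattice, i.e. the set of partitions of $\{1,\dots,2n\}$ all of whose blocks induce connected subgraphs, with $\pi\le\rho$ if $\pi$ refines $\rho$. For a finite ranked poset $P$ of length $\ell$ with minimum $\hat 0$ let $\chi_P(t)=\sum_{x\in P}\mu_P(\hat 0,x)\,t^{\ell-\mathrm{rk}(x)}$ be its characteristic polynomial, and let $(a)_n=a(a-1)\cdots(a-n+1)$. Then, as formal power series in $u$ over $\mathbb Z[t]$, $$\sum_{n\ge1}\chi_{\mathcal L(\mathcal H_{2n-1})}(t)\,u^n=\sum_{n\ge1}\chi_{\Pi_{\Gamma_{2n}}}(t)\,u^n=\sum_{n\ge1}\frac{(t-1)_n\,(t-1)_{n-1}\,u^n}{\prod_{k=1}^n\bigl(1-k(t-k)u\bigr)}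 .$$ Moreover, let a Dumont permutation of $\{1,\dots,2m\}$ be a permutation $\sigma$ with $\sigma(2i)<2i$ and $\sigma(2i-1)\ge 2i-1$ for $i=1,\dots,m$, let the Genocchi number $g_n$ ($n\ge1$) be the number of Dumont permutations of $\{1,\dots,2n-2\}$, and let the median Genocchi number $h_n$ ($n\ge0$) be the number of Dumont permutations of $\{1,\dots,2n+2\}$ without fixed points. Then for all $n\ge1$ we have $\chi_{\mathcal L(\mathcal H_{2n-1})}(0)=-g_n$ and $\chi_{\mathcal L(\mathcal H_{2n-1})}(-1)=-h_n$, and at $t=0$ and $t=-1$ the $n$-th term of the right-hand side above becomes the negative of the $n$-th term of the right-hand sides of $$\sum_{n\ge1}g_nu^n=\sum_{n\ge1}\frac{(n-1)!\,n!\,u^n}{\prod_{k=1}^n(1+k^2u)}\qquad\text{and}\qquad\sum_{n\ge1}h_nu^n=\sum_{n\ge1}\frac{n!\,(n+1)!\,u^n}{\prod_{k=1}^n\bigl(1+k(k+1)u\bigr)}$$ respectively; both of these Barsky–Dumont formulas hold. -/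

import Mathlib

/-! ### Characteristic polynomial of a finite poset -/

/-- The characteristic polynomial `∑ x, μ(⊥, x) t ^ (ℓ - rk x)` of a finite (ranked) poset with a
minimum element. Here `ℓ` is the length of the poset (the number of steps of a longest chain,
`Order.krullDim`) and `rk x` is the length of a longest chain ending in `x` (`Order.height`). -/
noncomputable def charPoly (P : Type*) [PartialOrder P] [OrderBot P] [Finite P] : Polynomial ℤ :=
  open Classical in
  letI : Fintype P := Fintype.ofFinite P
  letI : LocallyFiniteOrder P := Fintype.toLocallyFiniteOrder
  ∑ x : P, Polynomial.C (IncidenceAlgebra.mu ℤ (⊥ : P) x) *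
    Polynomial.X ^ (((Order.krullDim P).unbotD 0).toNat - (Order.height x).toNat)

/-! ### Hyperplane arrangements and their intersection posets -/

/-- A finite collection of affine subspaces of codimension one. -/
structure HyperplaneArrangement (k E : Type*) [Field k] [AddCommGroup E] [Module k E] where
  hyperplanes : Set (AffineSubspace k E)
  finite : hyperplanes.Finite
  codim_one : ∀ H ∈ hyperplanes,
    (H : Set E).Nonempty ∧ Module.finrank k (E ⧸ H.direction) = 1

namespace HyperplaneArrangement

variable {k E : Type*} [Field k] [AddCommGroup E] [Module k E]

/-- The nonempty intersections of hyperplanes of the arrangement (the whole space being the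
empty intersection), ordered by reverse inclusion. -/
abbrev IntersectionPoset (A : HyperplaneArrangement k E) : Type _ :=
  {S : (AffineSubspace k E)ᵒᵈ //
    ∃ B ⊆ A.hyperplanes, OrderDual.ofDual S = sInf B ∧
      ((OrderDual.ofDual S : AffineSubspace k E) : Set E).Nonempty}

instance (A : HyperplaneArrangement k E) : OrderBot A.IntersectionPoset where
  bot := ⟨OrderDual.toDual ⊤, ∅, Set.empty_subset _, by simp, ⟨0, by simp⟩⟩
  bot_le S := by
    change (OrderDual.ofDual S.1 : AffineSubspace k E) ≤ ⊤
    exact le_top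

instance (A : HyperplaneArrangement k E) : Finite A.IntersectionPoset := by
  have h : {S : (AffineSubspace k E)ᵒᵈ |
      ∃ B ⊆ A.hyperplanes, OrderDual.ofDual S = sInf B ∧
        ((OrderDual.ofDual S : AffineSubspace k E) : Set E).Nonempty}.Finite := by
    refine (A.finite.finite_subsets.image fun B => OrderDual.toDual (sInf B)).subset ?_
    rintro S ⟨B, hB, hS, -⟩
    exact ⟨B, hB, congrArg OrderDual.toDual hS.symm⟩
  exact h.to_subtype

end HyperplaneArrangement

/-- The space `ℝ ^ (2n+1)` with coordinates `x_1, …, x_{n+1}` (first component) and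
`y_1, …, y_n` (second component). -/
abbrev LinialSpace (n : ℕ) : Type := (Fin (n + 1) → ℝ) × (Fin n → ℝ)

/-- The hyperplane `x_i - x_j = y_i`. -/
def linialHyperplane (n : ℕ) (i : Fin n) (j : Fin (n + 1)) : AffineSubspace ℝ (LinialSpace n) where
  carrier := {v | v.1 i.castSucc - v.1 j = v.2 i}
  smul_vsub_vadd_mem' c p₁ p₂ p₃ h₁ h₂ h₃ := by
    simp only [Set.mem_ofPred_eq, vsub_eq_sub, vadd_eq_add, Prod.fst_add, Prod.smul_fst,
      Prod.fst_sub, Prod.snd_add, Prod.smul_snd, Prod.snd_sub, Pi.add_apply, Pi.smul_apply,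
      Pi.sub_apply, smul_eq_mul] at *
    rw [← h₁, ← h₂, ← h₃]
    ring

theorem linialHyperplane_codim_one (n : ℕ) (i : Fin n) (j : Fin (n + 1)) :
    (linialHyperplane n i j : Set (LinialSpace n)).Nonempty ∧
      Module.finrank ℝ (LinialSpace n ⧸ (linialHyperplane n i j).direction) = 1 := by
  let f : LinialSpace n →ₗ[ℝ] ℝ :=
    { toFun := fun v => v.1 i.castSucc - v.1 j - v.2 i
      map_add' := fun v w => by simp; ring
      map_smul' := fun c v => by simp; ring }
  have h : linialHyperplane n i j = (LinearMap.ker f).toAffineSubspace := by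
    ext v
    change v.1 i.castSucc - v.1 j = v.2 i ↔ v.1 i.castSucc - v.1 j - v.2 i = 0
    exact sub_eq_zero.symm
  have hf : Function.Surjective f := fun c =>
    ⟨(0, fun _ => -c), by simp [f]⟩
  refine ⟨⟨0, ?_⟩, ?_⟩
  · change (0 : ℝ) - 0 = 0
    simp
  · rw [h, Submodule.toAffineSubspace_direction,
      (f.quotKerEquivOfSurjective hf).finrank_eq, Module.finrank_self]

/-- The homogenized Linial arrangement `H_{2n-1} = {x_i - x_j = y_i : 1 ≤ i < j ≤ n+1}` in
`ℝ ^ (2n+1)`. -/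
def homogenizedLinial (n : ℕ) : HyperplaneArrangement ℝ (LinialSpace n) where
  hyperplanes := {H | ∃ (i : Fin n) (j : Fin (n + 1)), i.castSucc < j ∧ H = linialHyperplane n i j}
  finite := by
    refine (Set.finite_range fun p : Fin n × Fin (n + 1) => linialHyperplane n p.1 p.2).subset ?_
    rintro H ⟨i, j, -, rfl⟩
    exact ⟨(i, j), rfl⟩
  codim_one := by
    rintro H ⟨i, j, -, rfl⟩
    exact linialHyperplane_codim_one n i j

/-! ### Bond lattices -/

/-- The bond lattice of a graph: the partitions of the vertex set (given by their equivalence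
relations) each of whose blocks induces a connected subgraph. `π ≤ ρ` means that `π` refines
`ρ`. -/
abbrev BondLattice {V : Type*} (G : SimpleGraph V) : Type _ :=
  {π : Setoid V // ∀ B ∈ π.classes, (G.induce B).Connected}

instance {V : Type*} (G : SimpleGraph V) : OrderBot (BondLattice G) where
  bot := ⟨⊥, by
    rintro B ⟨v, rfl⟩
    have : {x | (⊥ : Setoid V) x v} = {v} := by
      ext x
      simp
    rw [this]
    exact { preconnected := .of_subsingleton, nonempty := ⟨⟨v, rfl⟩⟩ }⟩
  bot_le π := (bot_le : (⊥ : Setoid V) ≤ π.1)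

instance {V : Type*} [Finite V] (G : SimpleGraph V) : Finite (BondLattice G) := by
  have : Finite (Setoid V) :=
    Finite.of_injective (fun r : Setoid V => (r : V → V → Prop)) fun r s h => by
      ext a b
      exact iff_of_eq (congrFun (congrFun h a) b)
  exact Subtype.finite

/-- The bipartite graph `Γ_{2n}` on `{1, …, 2n}` in which an odd `u` and an even `v` are adjacent
if and only if `u < v`. -/
def gammaGraph (n : ℕ) : SimpleGraph (Finset.Icc 1 (2 * n)) :=
  SimpleGraph.fromRel fun u v => Odd u.1 ∧ Even v.1 ∧ u < v

/-! ### Genocchi numbers and median Genocchi numbers -/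

/-- Dumont permutations of `{1, …, 2m}`. -/
def IsDumont {m : ℕ} (σ : Equiv.Perm (Finset.Icc 1 (2 * m))) : Prop :=
  ∀ i, (Even i.1 → σ i < i) ∧ (Odd i.1 → i ≤ σ i)

/-- The Genocchi number `g_n`, `n ≥ 1`: the number of Dumont permutations of `{1, …, 2n-2}`
(the value at `n = 0` is not used). -/
noncomputable def genocchi (n : ℕ) : ℕ :=
  Nat.card {σ : Equiv.Perm (Finset.Icc 1 (2 * (n - 1))) // IsDumont σ}

/-- The median Genocchi number `h_n`: the number of Dumont permutations of `{1, …, 2n+2}` without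
fixed points. -/
noncomputable def medianGenocchi (n : ℕ) : ℕ :=
  Nat.card {σ : Equiv.Perm (Finset.Icc 1 (2 * (n + 1))) // IsDumont σ ∧ ∀ i, σ i ≠ i}

/-! ### Formal power series -/

open scoped PowerSeries.WithPiTopology in
/-- `∑ n, f n = F` as formal power series: every coefficient of the partial sums is eventually
constant, equal to that of `F` (convergence for the product of the discrete topologies). -/
def HasFormalSum {R : Type*} [CommRing R] (f : ℕ → PowerSeries R) (F : PowerSeries R) : Prop :=
  letI : TopologicalSpace R := ⊥
  HasSum f F

/-- `∑_{n ≥ 1} a_n u ^ n`. -/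
def genFun {R : Type*} [CommRing R] (a : ℕ → R) : PowerSeries R :=
  PowerSeries.mk fun n => if n = 0 then 0 else a n

/-- The falling factorial `(t-1)_n = (t-1)(t-2)⋯(t-n)`, a polynomial in `t`. -/
noncomputable def fallingTSubOne (n : ℕ) : Polynomial ℤ :=
  (descPochhammer ℤ n).comp (Polynomial.X - 1)

/-- `(t-1)_n (t-1)_{n-1} u ^ n / ∏_{k=1}^n (1 - k (t-k) u)`, for `n ≥ 1`, where `t` is the
polynomial variable and `u` the power series variable. The denominator has constant coefficient
one, and `PowerSeries.invOfUnit _ 1` is its inverse. -/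
noncomputable def charTerm (n : ℕ) : PowerSeries (Polynomial ℤ) :=
  PowerSeries.C (fallingTSubOne n * fallingTSubOne (n - 1)) * PowerSeries.X ^ n *
    PowerSeries.invOfUnit
      (∏ k ∈ Finset.Icc 1 n,
        (1 - PowerSeries.C ((k : Polynomial ℤ) * (Polynomial.X - (k : Polynomial ℤ))) *
          PowerSeries.X)) 1

/-- `(n-1)! n! u ^ n / ∏_{k=1}^n (1 + k² u)`, for `n ≥ 1`. -/
noncomputable def genocchiTerm (n : ℕ) : PowerSeries ℤ :=
  PowerSeries.C (((n - 1).factorial : ℤ) * (n.factorial : ℤ)) * PowerSeries.X ^ n *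
    PowerSeries.invOfUnit
      (∏ k ∈ Finset.Icc 1 n, (1 + PowerSeries.C ((k : ℤ) ^ 2) * PowerSeries.X)) 1

/-- `n! (n+1)! u ^ n / ∏_{k=1}^n (1 + k (k+1) u)`. -/
noncomputable def medianGenocchiTerm (n : ℕ) : PowerSeries ℤ :=
  PowerSeries.C ((n.factorial : ℤ) * ((n + 1).factorial : ℤ)) * PowerSeries.X ^ n *
    PowerSeries.invOfUnit
      (∏ k ∈ Finset.Icc 1 n, (1 + PowerSeries.C ((k : ℤ) * ((k : ℤ) + 1)) * PowerSeries.X)) 1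

/-!
Write `t` for the number of colours.

*Reduction to colourings.* In the coordinates `x_i - y_i` and `x_{j+1}` the homogenized Linial
arrangement is the graphic arrangement of `Γ_{2n}` (times a line), so its intersection poset is
isomorphic to the bond lattice of `Γ_{2n}` (`nonempty_bondLattice_orderIso`). The rank of a partition
in a bond lattice is the number of vertices minus the number of blocks (`height_bondLattice`), and
Möbius inversion shows that `t χ(t)` is the chromatic polynomial (`eval_charPoly_bondLattice`).

*Colouring `Γ_{2n}`.* Colour the vertices in the order `1, 2, 3, …`. All that matters for the rest is
the number `k` of colours used by the odd vertices so far: the number `c_n(k)` of extensions by `n`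
further pairs satisfies `c_0(k) = 1` and
`c_{n+1}(k) = k (t-k) c_n(k) + (t-k)(t-k-1) c_n(k+1)` (`extensionCount`, `card_colouring_pairs`),
so that `χ = (t-1) c_{n-1}(1)`. Clearing the denominator `1 - k(t-k)u`, the coefficients of the terms
of the series satisfy the transposed recursion, hence they sum to the same thing
(`sum_coeff_charTerm_mul_extensionCount`).

*Dumont permutations.* The condition `σ(p) ≥ p` at an odd `p` is the difference of no condition and
the condition `σ(p) < p`. Among the conditions `σ(p) < p`, those with a smaller `p` bound a smaller
set of values, so choosing these values in increasing order of `p` the number of choices depends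
only on the number `u` of postponed (unconstrained) positions. This gives a recursion in `u` of
Gandhi's type (`gandhi`, `injSum_dumont`), and likewise for Dumont permutations without fixed points,
where `σ(p) > p` at odd `p`. Up to a factorial these recursions are those of `c_n(k)` at `t = 0` and
`t = -1` (`mul_gandhi_zero`, `gandhi_one_succ`). The two Barsky–Dumont formulas are then the
specializations of the generating function of the characteristic polynomials.
-/

/-! ### Möbius functions and characteristic polynomials -/

/-- The characteristic polynomial in terms of a function `m`, the Möbius function `μ(⊥, ·)`, that is
determined by its sums over principal lower sets. This frees it from the choice of instances in
`charPoly`. -/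
theorem exists_moebius (P : Type*) [PartialOrder P] [OrderBot P] [Fintype P] :
    open Classical in
    ∃ m : P → ℤ, (∀ y, ∑ x with x ≤ y, m x = if y = ⊥ then 1 else 0) ∧
      charPoly P = ∑ x, Polynomial.C (m x) *
        Polynomial.X ^ (((Order.krullDim P).unbotD 0).toNat - (Order.height x).toNat) := by
  classical
  let : LocallyFiniteOrder P := Fintype.toLocallyFiniteOrder
  refine ⟨fun x => IncidenceAlgebra.mu ℤ (⊥ : P) x, fun y => ?_, ?_⟩
  · have h := IncidenceAlgebra.sum_Icc_mu_right (𝕜 := ℤ) (⊥ : P) y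
    rw [← (Finset.filter_congr (fun x _ => by simp) : Finset.univ.filter (· ∈ Finset.Icc ⊥ y) = _),
      Finset.filter_mem_eq_inter, Finset.univ_inter, h]
    simp only [eq_comm]
  · unfold charPoly
    refine Finset.sum_congr ?_ fun x _ => ?_
    · ext; simp
    · congr!

/-- Two functions on a finite poset with the same sums over all principal lower sets agree. -/
theorem eq_of_lower_sums_eq {P : Type*} [PartialOrder P] [Fintype P] [DecidableLE P]
    {m m' : P → ℤ} (h : ∀ y, ∑ x with x ≤ y, m x = ∑ x with x ≤ y, m' x) : m = m' := by
  classical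
  funext y
  induction y using WellFoundedLT.induction with
  | ind y ih =>
    have key : ∀ f : P → ℤ, ∑ x with x ≤ y, f x = f y + ∑ x with x < y, f x := fun f => by
      rw [← Finset.sum_insert (by simp)]
      refine Finset.sum_congr ?_ fun _ _ => rfl
      ext x
      simp [le_iff_eq_or_lt]
    have hy := h y
    rw [key, key, Finset.sum_congr rfl fun x hx => ih x (by simpa using hx)] at hy
    exact add_right_cancel hy

theorem charPoly_congr {P Q : Type*} [PartialOrder P] [OrderBot P] [Finite P]
    [PartialOrder Q] [OrderBot Q] [Finite Q] (e : P ≃o Q) : charPoly P = charPoly Q := by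
  classical
  have := Fintype.ofFinite P
  have := Fintype.ofFinite Q
  obtain ⟨m, hm, hP⟩ := exists_moebius P
  obtain ⟨m', hm', hQ⟩ := exists_moebius Q
  have h : m = m' ∘ e := by
    refine eq_of_lower_sums_eq fun y => ?_
    rw [hm]
    have h1 : ∑ x with x ≤ y, (m' ∘ e) x = ∑ x with x ≤ e y, m' x := by
      rw [Finset.sum_filter, Finset.sum_filter]
      exact Fintype.sum_equiv e.toEquiv _ _ fun x => by simp
    rw [h1, hm']
    simp
  rw [hP, hQ, h]
  refine Fintype.sum_equiv e.toEquiv _ _ fun x => ?_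
  simp [Order.krullDim_eq_of_orderIso e]

/-! ### Bond lattices in terms of reachability -/

section Bond

variable {V : Type*} {G : SimpleGraph V}

/-- The edges of `G` inside the blocks of `π`. -/
def blockGraph (G : SimpleGraph V) (π : Setoid V) : SimpleGraph V where
  Adj u v := G.Adj u v ∧ π u v
  symm := ⟨fun _ _ h => ⟨h.1.symm, π.symm' h.2⟩⟩
  loopless := ⟨fun _ h => h.1.ne rfl⟩

theorem blockGraph_mono {π ρ : Setoid V} (h : π ≤ ρ) : blockGraph G π ≤ blockGraph G ρ :=
  fun _ _ huv => ⟨huv.1, h huv.2⟩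

/-- The blocks of `π` induce connected subgraphs if and only if any two elements of a block are
joined by a walk inside it. -/
theorem blocks_connected_iff {π : Setoid V} :
    (∀ B ∈ π.classes, (G.induce B).Connected) ↔
      ∀ a b, π a b → (blockGraph G π).Reachable a b := by
  constructor
  · intro h a b hab
    have hB := h {x | π x b} ⟨b, rfl⟩
    let φ : G.induce {x | π x b} →g blockGraph G π :=
      ⟨Subtype.val, fun {u v} huv => ⟨huv, π.trans' u.2 (π.symm' v.2)⟩⟩
    exact (hB.preconnected ⟨a, hab⟩ ⟨b, π.refl' b⟩).map φ
  · rintro h _ ⟨v, rfl⟩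
    have key : ∀ x w, (blockGraph G π).Walk x w → ∀ (hx : π x v) (hw : π w v),
        (G.induce {x | π x v}).Reachable ⟨x, hx⟩ ⟨w, hw⟩ := by
      intro x w p
      induction p with
      | nil => exact fun _ _ => .refl _
      | cons hadj p ih =>
        intro hx hw
        have hy := π.trans' (π.symm' hadj.2) hx
        exact (SimpleGraph.Adj.reachable (by exact hadj.1)).trans (ih hy hw)
    refine (SimpleGraph.connected_iff _).2 ⟨fun x y => ?_, ⟨⟨v, π.refl' v⟩⟩⟩
    obtain ⟨p⟩ := h x y (π.trans' x.2 (π.symm' y.2))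
    exact key _ _ p _ _

theorem BondLattice.reachable (π : BondLattice G) {a b : V} (h : π.1 a b) :
    (blockGraph G π.1).Reachable a b :=
  blocks_connected_iff.1 π.2 a b h

/-- The partition into connected components of a subgraph `H` of `G`. -/
def componentPartition {H : SimpleGraph V} (hH : H ≤ G) : BondLattice G :=
  ⟨H.reachableSetoid, blocks_connected_iff.2 fun _ _ hab =>
    SimpleGraph.Reachable.mono (fun _ _ huv => ⟨hH huv, huv.reachable⟩) hab⟩

/-- An equivalence relation that contains the edges of `H` contains its reachability relation. -/
theorem rel_of_reachable {H : SimpleGraph V} {r : Setoid V} (h : ∀ a b, H.Adj a b → r a b)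
    {a b : V} (hab : H.Reachable a b) : r a b := by
  obtain ⟨p⟩ := hab
  induction p with
  | nil => exact r.refl' _
  | cons hadj _ ih => exact r.trans' (h _ _ hadj) ih

/-! ### The rank function of a bond lattice -/

/-- The number of blocks of a partition. -/
noncomputable def numBlocks (π : Setoid V) : ℕ := Nat.card (Quotient π)

theorem numBlocks_lt [Finite V] {π ρ : Setoid V} (h : π < ρ) : numBlocks ρ < numBlocks π := by
  classical
  have := Fintype.ofFinite (Quotient π)
  have := Fintype.ofFinite (Quotient ρ)
  rw [numBlocks, numBlocks, Nat.card_eq_fintype_card, Nat.card_eq_fintype_card]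
  refine Fintype.card_lt_of_surjective_not_injective
    (Quotient.map' id h.le : Quotient π → Quotient ρ) ?_ fun hinj => h.not_ge ?_
  · rintro ⟨x⟩
    exact ⟨Quotient.mk π x, rfl⟩
  · intro a b hab
    exact Quotient.exact (hinj (Quotient.sound hab : Quotient.mk ρ a = Quotient.mk ρ b) :
      Quotient.mk π a = Quotient.mk π b)

/-- Below a partition `ρ` and strictly above `π`, one can merge two blocks of `π` along an edge
of `G` inside a block of `ρ`. -/
theorem exists_merge [Finite V] {π ρ : BondLattice G} (h : π < ρ) :
    ∃ σ : BondLattice G, π < σ ∧ σ ≤ ρ ∧ numBlocks π.1 ≤ numBlocks σ.1 + 1 := by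
  classical
  obtain ⟨u, v, hG, hρ, hπ⟩ : ∃ u v, G.Adj u v ∧ ρ.1 u v ∧ ¬ π.1 u v := by
    by_contra! hcon
    exact h.not_ge fun a b hab => rel_of_reachable (H := blockGraph G ρ.1)
      (fun c d hcd => hcon c d hcd.1 hcd.2) (ρ.reachable hab)
  -- `φ` sends the block of `u` to that of `v` and fixes all other blocks
  let φ : Quotient π.1 → Quotient π.1 := fun c => if c = ⟦u⟧ then ⟦v⟧ else c
  let σ : Setoid V := Setoid.ker fun a => φ ⟦a⟧
  have hle : π.1 ≤ σ := fun a b hab => by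
    change φ ⟦a⟧ = φ ⟦b⟧
    rw [Quotient.sound hab]
  have huv : σ u v := by
    change φ ⟦u⟧ = φ ⟦v⟧
    simp [φ]
  have hcases : ∀ (r : Setoid V) (_ : π.1 ≤ r) (_ : r u v) {a b}, σ a b → r a b := by
    intro r hr hruv a b hab
    have hab' : φ ⟦a⟧ = φ ⟦b⟧ := hab
    have hex : ∀ {x y}, (⟦x⟧ : Quotient π.1) = ⟦y⟧ → r x y := fun h => hr (Quotient.exact h)
    by_cases ha : (⟦a⟧ : Quotient π.1) = ⟦u⟧ <;> by_cases hb : (⟦b⟧ : Quotient π.1) = ⟦u⟧ <;>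
      simp only [φ, ha, hb, if_true, if_false] at hab'
    · exact r.trans' (hex ha) (r.symm' (hex hb))
    · exact r.trans' (r.trans' (hex ha) hruv) (hex hab')
    · exact r.trans' (hex hab') (r.trans' (r.symm' hruv) (r.symm' (hex hb)))
    · exact hex hab'
  have hσ : ∀ a b, σ a b → (blockGraph G σ).Reachable a b := fun a b hab =>
    hcases (blockGraph G σ).reachableSetoid
      (fun c d hcd => (π.reachable hcd).mono (blockGraph_mono hle))
      (SimpleGraph.Adj.reachable (⟨hG, huv⟩ : (blockGraph G σ).Adj u v)) hab
  refine ⟨⟨σ, blocks_connected_iff.2 hσ⟩, lt_of_le_not_ge hle fun hge => hπ (hge huv),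
    fun a b => hcases ρ.1 h.le hρ, ?_⟩
  -- only the block of `u` is lost
  let g : Quotient π.1 → Option (Quotient σ) := fun c =>
    if c = ⟦u⟧ then none else some (Quotient.map' id hle c)
  have hg : Function.Injective g := by
    rintro ⟨a⟩ ⟨b⟩ hab
    change g ⟦a⟧ = g ⟦b⟧ at hab
    change (⟦a⟧ : Quotient π.1) = ⟦b⟧
    by_cases ha : (⟦a⟧ : Quotient π.1) = ⟦u⟧ <;> by_cases hb : (⟦b⟧ : Quotient π.1) = ⟦u⟧ <;>
      simp only [g, ha, hb, if_true, if_false, reduceCtorEq, Option.some.injEq] at hab ⊢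
    have h' : φ ⟦a⟧ = φ ⟦b⟧ := (Quotient.exact hab : σ a b)
    simpa only [φ, ha, hb, if_false] using h'
  have := Nat.card_le_card_of_injective g hg
  rwa [Finite.card_option] at this

theorem numBlocks_bot [Finite V] : numBlocks (⊥ : BondLattice G).1 = Nat.card V := by
  refine (Nat.card_congr (Equiv.ofBijective
    (Quotient.mk (⊥ : BondLattice G).1) ⟨fun a b h => ?_, Quotient.mk_surjective⟩)).symm
  exact (Quotient.exact h : (⊥ : Setoid V) a b)

theorem numBlocks_le [Finite V] (π : BondLattice G) : numBlocks π.1 ≤ Nat.card V := by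
  rw [← numBlocks_bot (G := G)]
  obtain h | h := (bot_le : ⊥ ≤ π).eq_or_lt
  · rw [h]
  · exact (numBlocks_lt h).le

/-- Merging blocks one pair at a time gives a long chain from `π` to `ρ`. -/
theorem height_add_le [Finite V] (ρ π : BondLattice G) (h : π ≤ ρ) :
    Order.height π + (numBlocks π.1 - numBlocks ρ.1 : ℕ) ≤ Order.height ρ := by
  induction hn : numBlocks π.1 using Nat.strong_induction_on generalizing π with
  | _ n ih =>
    subst hn
    obtain rfl | hlt := h.eq_or_lt
    · simp
    obtain ⟨σ, hπσ, hσρ, hc⟩ := exists_merge hlt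
    refine le_trans ?_ (ih _ (numBlocks_lt hπσ) σ hσρ rfl)
    have h1 : (numBlocks π.1 - numBlocks ρ.1 : ℕ) ≤ (1 + (numBlocks σ.1 - numBlocks ρ.1) : ℕ) := by
      omega
    calc Order.height π + (numBlocks π.1 - numBlocks ρ.1 : ℕ)
        ≤ Order.height π + (1 + (numBlocks σ.1 - numBlocks ρ.1) : ℕ) := by gcongr
      _ = (Order.height π + 1) + (numBlocks σ.1 - numBlocks ρ.1 : ℕ) := by
          push_cast; rw [add_assoc]
      _ ≤ _ := by gcongr; exact Order.height_add_one_le hπσ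

theorem height_bondLattice [Finite V] (π : BondLattice G) :
    Order.height π = (Nat.card V - numBlocks π.1 : ℕ) := by
  refine le_antisymm ?_ ?_
  · refine (Order.height_le_height_apply_of_strictMono
      (fun π : BondLattice G => Nat.card V - numBlocks π.1) (fun π ρ h => ?_) π).trans ?_
    · have := numBlocks_lt h
      have := numBlocks_le π
      change Nat.card V - _ < Nat.card V - _
      omega
    · rw [Order.height_nat]
  · have := height_add_le π ⊥ bot_le
    rwa [Order.height_bot, zero_add, numBlocks_bot] at this

theorem krullDim_bondLattice [Finite V] (hG : G.Connected) :
    ((Order.krullDim (BondLattice G)).unbotD 0).toNat = Nat.card V - 1 := by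
  have htop : ∀ a b, (⊤ : Setoid V) a b → (blockGraph G ⊤).Reachable a b := fun a b _ =>
    (hG.preconnected a b).mono fun _ _ h => ⟨h, trivial⟩
  let : OrderTop (BondLattice G) :=
    { top := ⟨⊤, blocks_connected_iff.2 htop⟩
      le_top := fun π => (le_top : π.1 ≤ ⊤) }
  have h1 : numBlocks (⊤ : BondLattice G).1 = 1 := by
    have := hG.nonempty
    refine Nat.card_eq_one_iff_unique.2 ⟨⟨?_⟩, ⟨Quotient.mk _ hG.nonempty.some⟩⟩
    rintro ⟨a⟩ ⟨b⟩
    exact Quotient.sound (trivial : (⊤ : Setoid V) a b)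
  rw [← Order.height_top_eq_krullDim, height_bondLattice, h1]
  exact ENat.toNat_natCast _

/-! ### Characteristic polynomials of bond lattices and proper colourings -/

/-- `t χ(t)`, for the characteristic polynomial `χ` of the bond lattice of a connected graph, is
the chromatic polynomial. -/
theorem eval_charPoly_bondLattice [Finite V] (hG : G.Connected) (q : ℕ) :
    (q : ℤ) * (charPoly (BondLattice G)).eval (q : ℤ) =
      Nat.card {f : V → Fin q // ∀ u v, G.Adj u v → f u ≠ f v} := by
  classical
  have := Fintype.ofFinite V
  have := Fintype.ofFinite (BondLattice G)
  obtain ⟨m, hm, hP⟩ := exists_moebius (BondLattice G)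
  have hpos : ∀ π : BondLattice G, 1 ≤ numBlocks π.1 := fun π => by
    have := hG.nonempty
    have : Nonempty (Quotient π.1) := ⟨Quotient.mk _ hG.nonempty.some⟩
    exact Nat.card_pos
  -- the components of the subgraph of monochromatic edges of a colouring
  let mono : (V → Fin q) → BondLattice G := fun f =>
    componentPartition (H := blockGraph G (Setoid.ker f)) fun _ _ h => h.1
  have hmono : ∀ (π : BondLattice G) f, π ≤ mono f ↔ π.1 ≤ Setoid.ker f := by
    intro π f
    constructor
    · exact fun h a b hab => rel_of_reachable (H := blockGraph G (Setoid.ker f))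
        (fun c d hcd => hcd.2) (h hab)
    · exact fun h a b hab => (π.reachable hab).mono (blockGraph_mono h)
  have hbot : ∀ f, mono f = ⊥ ↔ ∀ u v, G.Adj u v → f u ≠ f v := by
    intro f
    rw [eq_bot_iff]
    constructor
    · intro h u v huv hf
      exact huv.ne (h (SimpleGraph.Adj.reachable (⟨huv, hf⟩ : (blockGraph G _).Adj u v)))
    · intro h a b hab
      exact rel_of_reachable (H := blockGraph G (Setoid.ker f)) (r := ⊥)
        (fun c d hcd => absurd hcd.2 (h c d hcd.1)) hab
  have hcount : ∀ π : BondLattice G,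
      ((q : ℤ) ^ numBlocks π.1) = ∑ f : V → Fin q, if π ≤ mono f then 1 else 0 := by
    intro π
    -- a colouring that is constant on the blocks of `π` is a colouring of the blocks
    have e : {f : V → Fin q // π ≤ mono f} ≃ (Quotient π.1 → Fin q) :=
      { toFun := fun f => Quotient.lift f.1 fun a b hab => (hmono π f.1).1 f.2 hab
        invFun := fun g => ⟨fun a => g ⟦a⟧, (hmono π _).2 fun a b hab => by
          change g ⟦a⟧ = g ⟦b⟧
          rw [Quotient.sound hab]⟩
        left_inv := fun f => rfl
        right_inv := fun g => by
          funext c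
          induction c using Quotient.ind
          rfl }
    have h1 := Nat.card_congr e
    rw [Nat.card_fun, Nat.card_fin, Nat.card_eq_fintype_card, Fintype.card_subtype] at h1
    rw [Finset.sum_boole, h1]
    simp [numBlocks]
  have hexp : ∀ π : BondLattice G, (q : ℤ) * (q : ℤ) ^
      (((Order.krullDim (BondLattice G)).unbotD 0).toNat - (Order.height π).toNat) =
        (q : ℤ) ^ numBlocks π.1 := by
    intro π
    rw [krullDim_bondLattice hG, height_bondLattice, ENat.toNat_natCast, ← pow_succ']
    congr 1
    have := hpos π
    have := numBlocks_le π
    omega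
  calc (q : ℤ) * (charPoly (BondLattice G)).eval (q : ℤ)
      = ∑ π : BondLattice G, m π * (q : ℤ) ^ numBlocks π.1 := by
        rw [hP, Polynomial.eval_finsetSum, Finset.mul_sum]
        refine Finset.sum_congr rfl fun π _ => ?_
        rw [← hexp]
        simp
        ring
    _ = ∑ f : V → Fin q, ∑ π with π ≤ mono f, m π := by
        simp_rw [hcount, Finset.mul_sum]
        rw [Finset.sum_comm]
        refine Finset.sum_congr rfl fun f _ => ?_
        rw [Finset.sum_filter]
        simp
    _ = _ := by
        simp_rw [hm, hbot]
        rw [Finset.sum_boole, Nat.card_eq_fintype_card, Fintype.card_subtype]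

end Bond

/-! ### Graphic arrangements -/

section Graphic

variable {k E V : Type*} [Field k] [AddCommGroup E] [Module k E]

/-- Let `κ : E → (V → k)` be onto, with `κ 0 = 0`. If the hyperplanes of an arrangement in `E` are
the sets `{v | κ v a = κ v b}` for the edges `ab` of `G`, its intersection poset is isomorphic to
the bond lattice of `G`. -/
theorem nonempty_bondLattice_orderIso {G : SimpleGraph V} (A : HyperplaneArrangement k E)
    (κ : E → V → k) (hκ : Function.Surjective κ) (hκ0 : κ 0 = 0)
    (hA : ∀ H ∈ A.hyperplanes, ∃ a b, G.Adj a b ∧ ∀ v, v ∈ H ↔ κ v a = κ v b)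
    (hG : ∀ a b, G.Adj a b → ∃ H ∈ A.hyperplanes, ∀ v, v ∈ H ↔ κ v a = κ v b) :
    Nonempty (BondLattice G ≃o A.IntersectionPoset) := by
  classical
  -- the hyperplanes of the edges inside the blocks of `π`
  let hyp : BondLattice G → Set (AffineSubspace k E) := fun π =>
    {H ∈ A.hyperplanes | ∃ a b, G.Adj a b ∧ π.1 a b ∧ ∀ v, v ∈ H ↔ κ v a = κ v b}
  have hmem : ∀ π v, v ∈ sInf (hyp π) ↔ ∀ a b, π.1 a b → κ v a = κ v b := by
    intro π v
    rw [← SetLike.mem_coe, AffineSubspace.coe_sInf, Set.mem_iInter₂]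
    constructor
    · intro h a b hab
      refine rel_of_reachable (H := blockGraph G π.1) (r := Setoid.ker (κ v)) (fun c d hcd => ?_)
        (π.reachable hab)
      obtain ⟨H, hH, hv⟩ := hG c d hcd.1
      exact (hv v).1 (h H ⟨hH, c, d, hcd.1, hcd.2, hv⟩)
    · rintro h H ⟨-, a, b, -, hab, hv⟩
      exact (hv v).2 (h a b hab)
  let F : BondLattice G → A.IntersectionPoset := fun π =>
    ⟨OrderDual.toDual (sInf (hyp π)), hyp π, Set.sep_subset _ _, rfl, 0, by
      change 0 ∈ sInf (hyp π)
      rw [hmem]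
      intro a b _
      rw [hκ0]
      rfl⟩
  have hF : ∀ π ρ, F π ≤ F ρ ↔ π ≤ ρ := by
    intro π ρ
    change sInf (hyp ρ) ≤ sInf (hyp π) ↔ _
    constructor
    · intro h a b hab
      -- the indicator function of the block of `b` in `ρ`
      obtain ⟨v, hv⟩ := hκ fun c => if ρ.1 c b then 1 else 0
      have h1 : v ∈ sInf (hyp ρ) := by
        rw [hmem, hv]
        intro c d hcd
        have : ρ.1 c b ↔ ρ.1 d b :=
          ⟨fun h => ρ.1.trans' (ρ.1.symm' hcd) h, fun h => ρ.1.trans' hcd h⟩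
        simp [this]
      have h2 := (hmem π v).1 (h h1) a b hab
      by_contra hcon
      simp [hv, hcon] at h2
    · intro h v hv
      rw [hmem] at hv ⊢
      exact fun a b hab => hv a b (h hab)
  have hsurj : Function.Surjective F := by
    rintro ⟨S, B, hB, hS, -⟩
    -- the edges whose hyperplanes contain the given intersection
    let H : SimpleGraph V :=
      { Adj := fun a b => G.Adj a b ∧ ∀ v ∈ sInf B, κ v a = κ v b
        symm := ⟨fun _ _ h => ⟨h.1.symm, fun v hv => (h.2 v hv).symm⟩⟩
        loopless := ⟨fun _ h => h.1.ne rfl⟩ }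
    let π : BondLattice G := componentPartition (H := H) fun _ _ h => h.1
    refine ⟨π, Subtype.ext ?_⟩
    change OrderDual.toDual (sInf (hyp π)) = S
    rw [← OrderDual.toDual_ofDual S, hS]
    congr 1
    ext v
    rw [hmem]
    constructor
    · intro h
      rw [← SetLike.mem_coe, AffineSubspace.coe_sInf, Set.mem_iInter₂]
      intro K hK
      obtain ⟨a, b, hab, hv⟩ := hA K (hB hK)
      refine (hv v).2 (h a b (SimpleGraph.Adj.reachable (?_ : H.Adj a b)))
      exact ⟨hab, fun w hw => (hv w).1 (sInf_le hK hw)⟩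
    · intro hv a b hab
      exact rel_of_reachable (H := H) (r := Setoid.ker (κ v)) (fun c d hcd => hcd.2 v hv) hab
  exact ⟨RelIso.ofSurjective (⟨⟨F, fun a b h => le_antisymm ((hF a b).1 h.le)
    ((hF b a).1 h.ge)⟩, fun {a b} => hF a b⟩ : BondLattice G ↪o A.IntersectionPoset) hsurj⟩

end Graphic

/-! ### The homogenized Linial arrangement -/

section Linial

/-- The odd vertices of `Γ_{2n}`, numbered from `0`. -/
def oddVertex {n : ℕ} (i : Fin n) : Finset.Icc 1 (2 * n) :=
  ⟨2 * i + 1, by have := i.2; simp only [Finset.mem_Icc]; omega⟩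

/-- The even vertices of `Γ_{2n}`, numbered from `0`. -/
def evenVertex {n : ℕ} (j : Fin n) : Finset.Icc 1 (2 * n) :=
  ⟨2 * j + 2, by have := j.2; simp only [Finset.mem_Icc]; omega⟩

/-- The vertex set of `Γ_{2n}` as the disjoint union of its odd and its even vertices. -/
noncomputable def vertexEquiv (n : ℕ) : Fin n ⊕ Fin n ≃ Finset.Icc 1 (2 * n) :=
  Equiv.ofBijective (Sum.elim oddVertex evenVertex) (by
    constructor
    · rintro (i | i) (j | j) h <;> have h := congrArg Subtype.val h <;>
        simp only [Sum.elim_inl, Sum.elim_inr, oddVertex, evenVertex] at h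
      · exact congrArg _ (Fin.ext (by omega))
      · omega
      · omega
      · exact congrArg _ (Fin.ext (by omega))
    · rintro ⟨x, hx⟩
      rw [Finset.mem_Icc] at hx
      obtain ⟨r, hr | hr⟩ := Nat.even_or_odd' x
      · exact ⟨Sum.inr ⟨r - 1, by omega⟩, Subtype.ext (by simp [evenVertex]; omega)⟩
      · exact ⟨Sum.inl ⟨r, by omega⟩, Subtype.ext (by simp [oddVertex]; omega)⟩)

@[simp] theorem vertexEquiv_inl {n : ℕ} (i : Fin n) : vertexEquiv n (Sum.inl i) = oddVertex i := rfl
@[simp] theorem vertexEquiv_inr {n : ℕ} (i : Fin n) : vertexEquiv n (Sum.inr i) = evenVertex i := rfl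

theorem gammaGraph_adj_odd_even {n : ℕ} (i j : Fin n) :
    (gammaGraph n).Adj (oddVertex i) (evenVertex j) ↔ i ≤ j := by
  rw [gammaGraph, SimpleGraph.fromRel_adj]
  simp only [oddVertex, evenVertex, ne_eq, Subtype.mk.injEq, Subtype.mk_lt_mk, Nat.odd_iff,
    Nat.even_iff, Fin.le_def]
  omega

theorem gammaGraph_adj_even_odd {n : ℕ} (i j : Fin n) :
    (gammaGraph n).Adj (evenVertex j) (oddVertex i) ↔ i ≤ j := by
  rw [SimpleGraph.adj_comm, gammaGraph_adj_odd_even]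

theorem not_gammaGraph_adj_odd_odd {n : ℕ} (i j : Fin n) :
    ¬ (gammaGraph n).Adj (oddVertex i) (oddVertex j) := by
  rw [gammaGraph, SimpleGraph.fromRel_adj]
  simp only [oddVertex, Nat.even_iff]
  omega

theorem not_gammaGraph_adj_even_even {n : ℕ} (i j : Fin n) :
    ¬ (gammaGraph n).Adj (evenVertex i) (evenVertex j) := by
  rw [gammaGraph, SimpleGraph.fromRel_adj]
  simp only [evenVertex, Nat.odd_iff]
  omega

/-- A property of the edges of `Γ_{2n}` need only be checked with the odd end first. -/
theorem forall_gammaGraph_adj {n : ℕ} {p : Finset.Icc 1 (2 * n) → Finset.Icc 1 (2 * n) → Prop}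
    (hp : ∀ a b, p a b → p b a) :
    (∀ a b, (gammaGraph n).Adj a b → p a b) ↔
      ∀ i j : Fin n, i ≤ j → p (oddVertex i) (evenVertex j) := by
  constructor
  · exact fun h i j hij => h _ _ ((gammaGraph_adj_odd_even i j).2 hij)
  · intro h a b hab
    obtain ⟨(i | i), rfl⟩ := (vertexEquiv n).surjective a <;>
      obtain ⟨(j | j), rfl⟩ := (vertexEquiv n).surjective b
    · exact absurd hab (not_gammaGraph_adj_odd_odd i j)
    · exact h i j ((gammaGraph_adj_odd_even i j).1 hab)
    · exact hp _ _ (h j i ((gammaGraph_adj_even_odd j i).1 hab))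
    · exact absurd hab (not_gammaGraph_adj_even_even i j)

theorem gammaGraph_connected {n : ℕ} (hn : 1 ≤ n) : (gammaGraph n).Connected := by
  let a : Fin n := ⟨0, hn⟩
  let b : Fin n := ⟨n - 1, by omega⟩
  have hab : (gammaGraph n).Adj (oddVertex a) (evenVertex b) :=
    (gammaGraph_adj_odd_even a b).2 (Nat.zero_le _)
  have key : ∀ x, (gammaGraph n).Reachable (oddVertex a) x := by
    intro x
    obtain ⟨(i | i), rfl⟩ := (vertexEquiv n).surjective x
    · have : (gammaGraph n).Adj (evenVertex b) (oddVertex i) :=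
        (gammaGraph_adj_even_odd i b).2 (Nat.le_sub_one_of_lt i.2)
      exact hab.reachable.trans this.reachable
    · exact ((gammaGraph_adj_odd_even a i).2 (Nat.zero_le _) : (gammaGraph n).Adj _ _).reachable
  exact (SimpleGraph.connected_iff _).2 ⟨fun x y => (key x).symm.trans (key y), ⟨oddVertex a⟩⟩

/-- The coordinates in which the homogenized Linial arrangement is the graphic arrangement of
`Γ_{2n}`: `x_i - y_i` for the vertex `2i - 1` and `x_{j+1}` for the vertex `2j` (indices from `1`). -/
noncomputable def linialCoord (n : ℕ) (v : LinialSpace n) (w : Finset.Icc 1 (2 * n)) : ℝ :=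
  Sum.elim (fun i => v.1 i.castSucc - v.2 i) (fun j => v.1 j.succ) ((vertexEquiv n).symm w)

theorem linialCoord_odd {n : ℕ} (v : LinialSpace n) (i : Fin n) :
    linialCoord n v (oddVertex i) = v.1 i.castSucc - v.2 i := by
  rw [linialCoord, ← vertexEquiv_inl, Equiv.symm_apply_apply, Sum.elim_inl]

theorem linialCoord_even {n : ℕ} (v : LinialSpace n) (j : Fin n) :
    linialCoord n v (evenVertex j) = v.1 j.succ := by
  rw [linialCoord, ← vertexEquiv_inr, Equiv.symm_apply_apply, Sum.elim_inr]

theorem linialCoord_surjective (n : ℕ) : Function.Surjective (linialCoord n) := by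
  intro f
  let x : Fin (n + 1) → ℝ := Fin.cons 0 fun j => f (evenVertex j)
  refine ⟨(x, fun i => x i.castSucc - f (oddVertex i)), funext fun w => ?_⟩
  obtain ⟨(i | i), rfl⟩ := (vertexEquiv n).surjective w
  · simp [linialCoord_odd]
  · simp [linialCoord_even, x]

theorem mem_linialHyperplane_succ {n : ℕ} (i j : Fin n) (v : LinialSpace n) :
    v ∈ linialHyperplane n i j.succ ↔
      linialCoord n v (oddVertex i) = linialCoord n v (evenVertex j) := by
  rw [linialCoord_odd, linialCoord_even]
  change v.1 i.castSucc - v.1 j.succ = v.2 i ↔ _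
  constructor <;> intro h <;> linarith

theorem charPoly_homogenizedLinial (n : ℕ) :
    charPoly (homogenizedLinial n).IntersectionPoset = charPoly (BondLattice (gammaGraph n)) := by
  suffices h : Nonempty (BondLattice (gammaGraph n) ≃o (homogenizedLinial n).IntersectionPoset) by
    obtain ⟨e⟩ := h
    exact (charPoly_congr e).symm
  refine nonempty_bondLattice_orderIso (homogenizedLinial n)
    (linialCoord n) (linialCoord_surjective n) ?_ ?_ ?_
  · funext w
    obtain ⟨(i | i), rfl⟩ := (vertexEquiv n).surjective w
    · simp [linialCoord_odd]
    · simp [linialCoord_even]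
  · rintro H ⟨i, j, hij, rfl⟩
    obtain ⟨j, rfl⟩ := Fin.exists_succ_eq_of_ne_zero (Fin.ne_zero_of_lt hij)
    exact ⟨_, _, (gammaGraph_adj_odd_even i j).2 (Fin.castSucc_lt_succ_iff.1 hij),
      mem_linialHyperplane_succ i j⟩
  · refine (forall_gammaGraph_adj ?_).2 fun i j hij =>
      ⟨_, ⟨i, j.succ, Fin.castSucc_lt_succ_iff.2 hij, rfl⟩, mem_linialHyperplane_succ i j⟩
    rintro a b ⟨H, hH, hv⟩
    exact ⟨H, hH, fun v => by rw [hv, eq_comm]⟩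

end Linial

/-! ### Proper colourings of `Γ_{2n}` -/

/-- The number of ways to extend a colouring, with `q` colours, by `n` further pairs of an odd and
an even vertex of `Γ`, when the odd vertices so far use `k` colours. It makes sense for `q` in any
commutative ring. -/
def extensionCount {R : Type*} [CommRing R] (q : R) : ℕ → ℕ → R
  | 0, _ => 1
  | n + 1, k => k * (q - k) * extensionCount q n k +
      (q - k) * (q - k - 1) * extensionCount q n (k + 1)

theorem map_extensionCount {R S : Type*} [CommRing R] [CommRing S] (φ : R →+* S) (q : R) (n k : ℕ) :
    φ (extensionCount q n k) = extensionCount (φ q) n k := by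
  induction n generalizing k with
  | zero => simp [extensionCount]
  | succ n ih => simp [extensionCount, ih]

/-- The number of pairs of colourings of `n` odd and `n` even vertices in which an even vertex
avoids the set `S` and the colours of all smaller odd vertices. -/
theorem card_colouring_pairs {q : ℕ} (n : ℕ) (S : Finset (Fin q)) :
    (Fintype.card {c : Fin n → Fin q × Fin q //
      (∀ j, (c j).2 ∉ S) ∧ ∀ i j, i ≤ j → (c i).1 ≠ (c j).2} : ℤ) =
        extensionCount (q : ℤ) n S.card := by
  classical
  induction n generalizing S with
  | zero =>
    rw [extensionCount, Fintype.card_subtype]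
    simp
  | succ n ih =>
    have e : {c : Fin (n + 1) → Fin q × Fin q //
          (∀ j, (c j).2 ∉ S) ∧ ∀ i j, i ≤ j → (c i).1 ≠ (c j).2} ≃
        Σ a : Fin q, {b : Fin q // b ∉ insert a S} × {c : Fin n → Fin q × Fin q //
          (∀ j, (c j).2 ∉ insert a S) ∧ ∀ i j, i ≤ j → (c i).1 ≠ (c j).2} :=
      { toFun := fun c => ⟨(c.1 0).1, ⟨(c.1 0).2, by
            have h1 := c.2.1 0
            have h2 := c.2.2 0 0 le_rfl
            simp [h1, h2.symm]⟩,
          ⟨fun j => c.1 j.succ, fun j => by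
            have h1 := c.2.1 j.succ
            have h2 := c.2.2 0 j.succ (Fin.zero_le _)
            simp [h1, h2.symm], fun i j hij => c.2.2 _ _ (Fin.succ_le_succ_iff.2 hij)⟩⟩
        invFun := fun x => ⟨Fin.cons (x.1, x.2.1.1) x.2.2.1, by
          obtain ⟨a, ⟨b, hb⟩, c, hc1, hc2⟩ := x
          simp only [Finset.mem_insert, not_or] at hb hc1
          refine ⟨Fin.cases hb.2 fun j => (hc1 j).2, Fin.cases (Fin.cases ?_ ?_)
            fun i => Fin.cases ?_ ?_⟩
          · exact fun _ => Ne.symm hb.1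
          · exact fun j _ => Ne.symm (hc1 j).1
          · intro h
            simp at h
          · exact fun j hij => hc2 i j (Fin.succ_le_succ_iff.1 hij)⟩
        left_inv := fun c => by
          apply Subtype.ext
          funext j
          induction j using Fin.cases <;> rfl
        right_inv := fun x => rfl }
    rw [Fintype.card_congr e, Fintype.card_sigma]
    push_cast
    simp_rw [Fintype.card_prod]
    push_cast
    simp_rw [ih]
    have hc : ∀ a : Fin q, (Fintype.card {b : Fin q // b ∉ insert a S} : ℤ) =
        q - (insert a S).card := by
      intro a
      rw [Fintype.card_subtype_compl, Fintype.card_fin, Fintype.card_coe,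
        Nat.cast_sub (by simpa using Finset.card_le_univ (insert a S))]
    simp_rw [hc]
    -- the colour of the first odd vertex is either an old one, in `S`, or a new one
    rw [← Finset.sum_add_sum_compl S, extensionCount]
    congr 1
    · rw [Finset.sum_congr rfl fun a ha => by rw [Finset.insert_eq_of_mem ha], Finset.sum_const]
      simp
      ring
    · rw [Finset.sum_congr rfl fun a ha => by
        rw [Finset.card_insert_of_notMem (Finset.mem_compl.1 ha)], Finset.sum_const,
        Finset.card_compl, Fintype.card_fin, nsmul_eq_mul,
        Nat.cast_sub (by simpa using Finset.card_le_univ S)]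
      push_cast
      ring

/-- The chromatic polynomial of `Γ_{2n}`. -/
theorem card_colourings_gammaGraph (n q : ℕ) :
    (Nat.card {f : Finset.Icc 1 (2 * n) → Fin q // ∀ u v, (gammaGraph n).Adj u v → f u ≠ f v} : ℤ) =
      extensionCount (q : ℤ) n 0 := by
  rw [← Finset.card_empty (α := Fin q), ← card_colouring_pairs, ← Nat.card_eq_fintype_card]
  congr 1
  refine Nat.card_congr (Equiv.subtypeEquiv (((Equiv.arrowCongr (vertexEquiv n).symm
    (Equiv.refl _)).trans (Equiv.sumArrowEquivProdArrow _ _ _)).trans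
    (Equiv.arrowProdEquivProdArrow _ _ _).symm) fun f => ?_)
  rw [forall_gammaGraph_adj fun a b => Ne.symm]
  simp [Equiv.arrowProdEquivProdArrow, Equiv.sumArrowEquivProdArrow]

theorem charPoly_gammaGraph (n : ℕ) :
    charPoly (BondLattice (gammaGraph (n + 1))) =
      (Polynomial.X - 1) * extensionCount (Polynomial.X : Polynomial ℤ) n 1 := by
  refine mul_left_cancel₀ Polynomial.X_ne_zero (Polynomial.eq_of_infinite_eval_eq _ _
    ((Set.infinite_range_of_injective (Nat.cast_injective (R := ℤ))).mono ?_))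
  rintro _ ⟨q, rfl⟩
  have h := map_extensionCount (Polynomial.evalRingHom (q : ℤ)) Polynomial.X n 1
  simp only [Polynomial.coe_evalRingHom, Polynomial.eval_X] at h
  simp only [Set.mem_ofPred_eq, Polynomial.eval_mul, Polynomial.eval_X, Polynomial.eval_sub,
    Polynomial.eval_one, h]
  rw [eval_charPoly_bondLattice (gammaGraph_connected (by omega)), card_colourings_gammaGraph,
    extensionCount]
  push_cast
  ring

/-! ### The generating function -/

section Series

open PowerSeries

/-- If the `k`-th term of a series vanishes up to order `k`, its formal sum is found from finite sums
of coefficients. -/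
theorem hasFormalSum_of_coeff {R : Type*} [CommRing R] {f : ℕ → PowerSeries R} {F : PowerSeries R}
    (h0 : ∀ n k, n ≤ k → coeff n (f k) = 0)
    (h : ∀ n, ∑ k ∈ Finset.range n, coeff n (f k) = coeff n F) : HasFormalSum f F := by
  let : TopologicalSpace R := ⊥
  refine (PowerSeries.WithPiTopology.hasSum_iff_hasSum_coeff R).2 fun n => ?_
  rw [← h n]
  exact hasSum_sum_of_ne_finset_zero fun k hk => h0 n k (by simpa using hk)

theorem map_invOfUnit_one {R S : Type*} [CommRing R] [CommRing S] (φ : R →+* S) {P : PowerSeries R}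
    (hP : constantCoeff P = 1) :
    map φ (invOfUnit P 1) = invOfUnit (map φ P) 1 := by
  have h1 : map φ P * map φ (invOfUnit P 1) = 1 := by
    rw [← map_mul, mul_invOfUnit P 1 (by simpa using hP), map_one]
  have h2 : invOfUnit (map φ P) 1 * map φ P = 1 :=
    invOfUnit_mul _ 1 (by
      rw [← coeff_zero_eq_constantCoeff_apply, coeff_map, coeff_zero_eq_constantCoeff_apply, hP]
      simp)
  exact (left_inv_eq_right_inv h2 h1).symm

theorem invOfUnit_mul_one_mul {R : Type*} [CommRing R] {P Q : PowerSeries R}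
    (hP : constantCoeff P = 1) (hQ : constantCoeff Q = 1) :
    invOfUnit (P * Q) 1 * Q = invOfUnit P 1 := by
  have h1 : (invOfUnit (P * Q) 1 * Q) * P = 1 := by
    rw [mul_assoc, mul_comm Q P]
    exact invOfUnit_mul _ 1 (by simp [hP, hQ])
  exact left_inv_eq_right_inv h1 (mul_invOfUnit P 1 (by simpa using hP))

theorem constantCoeff_charTerm_factor (c : Polynomial ℤ) :
    constantCoeff (1 - C c * X : PowerSeries (Polynomial ℤ)) = 1 := by
  simp

theorem constantCoeff_charTerm_denominator (n : ℕ) :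
    constantCoeff (∏ k ∈ Finset.Icc 1 n,
      (1 - C ((k : Polynomial ℤ) * (Polynomial.X - (k : Polynomial ℤ))) * X) :
        PowerSeries (Polynomial ℤ)) = 1 := by
  rw [map_prod]
  exact Finset.prod_eq_one fun k _ => constantCoeff_charTerm_factor _

theorem fallingTSubOne_zero : fallingTSubOne 0 = 1 := by
  simp [fallingTSubOne]

theorem fallingTSubOne_succ (n : ℕ) :
    fallingTSubOne (n + 1) = fallingTSubOne n * (Polynomial.X - ((n + 1 : ℕ) : Polynomial ℤ)) := by
  rw [fallingTSubOne, descPochhammer_succ_right, Polynomial.mul_comp, fallingTSubOne]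
  congr 1
  simp
  ring

theorem coeff_charTerm_eq_zero {n k : ℕ} (h : n < k) : coeff n (charTerm k) = 0 := by
  rw [charTerm, mul_right_comm, coeff_mul_X_pow', if_neg (by omega)]

/-- The last factor of the denominator of a term, cleared. -/
theorem charTerm_succ_mul (k : ℕ) :
    charTerm (k + 1) * (1 - C (((k + 1 : ℕ) : Polynomial ℤ) * (Polynomial.X - ((k + 1 : ℕ) : Polynomial ℤ))) * X) =
      C (fallingTSubOne (k + 1) * fallingTSubOne k) * X ^ (k + 1) *
        invOfUnit (∏ j ∈ Finset.Icc 1 k,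
          (1 - C ((j : Polynomial ℤ) * (Polynomial.X - (j : Polynomial ℤ))) * X)) 1 := by
  rw [charTerm, Nat.add_sub_cancel, mul_assoc, Finset.prod_Icc_succ_top (by omega),
    invOfUnit_mul_one_mul (constantCoeff_charTerm_denominator k) (constantCoeff_charTerm_factor _)]

theorem coeff_charTerm_one (n : ℕ) :
    coeff (n + 1) (charTerm 1) =
      (Polynomial.X - 1) * coeff n (charTerm 1) + if n = 0 then Polynomial.X - 1 else 0 := by
  have h1 : invOfUnit (1 : PowerSeries (Polynomial ℤ)) 1 = 1 := by
    simpa using invOfUnit_mul (1 : PowerSeries (Polynomial ℤ)) 1 (by simp)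
  have h := charTerm_succ_mul 0
  rw [Finset.Icc_eq_empty (by omega), Finset.prod_empty, h1, fallingTSubOne_succ,
    fallingTSubOne_zero] at h
  have h3 := congrArg (coeff (n + 1)) h
  simp only [zero_add, Nat.cast_one, one_mul, mul_one, pow_one] at h3
  rw [mul_sub, mul_one, ← mul_assoc, map_sub, coeff_succ_mul_X, coeff_succ_mul_X,
    mul_comm (charTerm 1), coeff_C_mul, coeff_C] at h3
  rw [← h3]
  ring

theorem coeff_charTerm_succ_succ (n k : ℕ) :
    coeff (n + 1) (charTerm (k + 2)) =
      ((k + 2 : ℕ) : Polynomial ℤ) * (Polynomial.X - ((k + 2 : ℕ) : Polynomial ℤ)) * coeff n (charTerm (k + 2)) +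
      (Polynomial.X - ((k + 2 : ℕ) : Polynomial ℤ)) * (Polynomial.X - ((k + 1 : ℕ) : Polynomial ℤ)) * coeff n (charTerm (k + 1)) := by
  have h := charTerm_succ_mul (k + 1)
  have h2 : C (fallingTSubOne (k + 1 + 1) * fallingTSubOne (k + 1)) * X ^ (k + 1 + 1) *
        invOfUnit (∏ j ∈ Finset.Icc 1 (k + 1),
          (1 - C ((j : Polynomial ℤ) * (Polynomial.X - (j : Polynomial ℤ))) * X)) 1 =
      C ((Polynomial.X - ((k + 2 : ℕ) : Polynomial ℤ)) * (Polynomial.X - ((k + 1 : ℕ) : Polynomial ℤ))) * charTerm (k + 1) * X := by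
    rw [charTerm, fallingTSubOne_succ (k + 1), fallingTSubOne_succ k]
    simp only [map_mul, Nat.add_sub_cancel]
    ring
  rw [h2] at h
  have h3 := congrArg (coeff (n + 1)) h
  rw [mul_sub, mul_one, ← mul_assoc, map_sub, coeff_succ_mul_X, coeff_succ_mul_X, coeff_C_mul,
    mul_comm (charTerm _), coeff_C_mul] at h3
  rw [← h3]
  ring

/-- A row `A'` obtained from a row `A` by the recursion `coeff_charTerm_succ_succ`, paired with the
counts of extensions by `r` pairs, gives what `A` gives with the extensions by `r + 1` pairs, up to
a boundary term. -/
theorem sum_mul_extensionCount_succ {R : Type*} [CommRing R] (q : R) (r : ℕ) {A A' : ℕ → R}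
    (h0 : A' 0 = (q - 1) * A 0)
    (hs : ∀ k : ℕ, A' (k + 1) = ((k + 2 : ℕ) : R) * (q - ((k + 2 : ℕ) : R)) * A (k + 1) +
      (q - ((k + 2 : ℕ) : R)) * (q - ((k + 1 : ℕ) : R)) * A k) (N : ℕ) :
    ∑ k ∈ Finset.range (N + 1), A' k * extensionCount q r (k + 1) =
      ∑ k ∈ Finset.range N, A k * extensionCount q (r + 1) (k + 1) +
        ((N + 1 : ℕ) : R) * (q - ((N + 1 : ℕ) : R)) * A N * extensionCount q r (N + 1) := by
  induction N with
  | zero => simp [h0]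
  | succ N ih =>
    rw [Finset.sum_range_succ, ih, Finset.sum_range_succ _ N, hs, extensionCount]
    push_cast
    ring

/-- The `n`-th coefficients of the terms of the series count the colourings of the first `n` pairs
of vertices of `Γ` by the number of colours of the odd vertices, up to a factor. -/
theorem sum_coeff_charTerm_mul_extensionCount (n r : ℕ) :
    ∑ k ∈ Finset.range (n + 1), coeff (n + 1) (charTerm (k + 1)) *
        extensionCount (Polynomial.X : Polynomial ℤ) r (k + 1) =
      (Polynomial.X - 1) * extensionCount (Polynomial.X : Polynomial ℤ) (n + r) 1 := by
  induction n generalizing r with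
  | zero => simp [coeff_charTerm_one, coeff_charTerm_eq_zero]
  | succ n ih =>
    rw [sum_mul_extensionCount_succ Polynomial.X r (A := fun k => coeff (n + 1) (charTerm (k + 1)))
      (by simp [coeff_charTerm_one]) (coeff_charTerm_succ_succ (n + 1)) (n + 1), ih,
      coeff_charTerm_eq_zero (by omega), mul_zero, zero_mul, add_zero, add_right_comm, add_assoc]

theorem sum_coeff_charTerm (n : ℕ) :
    ∑ k ∈ Finset.range (n + 1), coeff (n + 1) (charTerm (k + 1)) =
      charPoly (BondLattice (gammaGraph (n + 1))) := by
  simpa [extensionCount, charPoly_gammaGraph] using sum_coeff_charTerm_mul_extensionCount n 0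

theorem hasFormalSum_charTerm :
    HasFormalSum (fun n : ℕ => charTerm (n + 1))
      (genFun fun n => charPoly (BondLattice (gammaGraph n))) := by
  refine hasFormalSum_of_coeff (fun n k h => coeff_charTerm_eq_zero (by omega)) fun n => ?_
  obtain _ | n := n
  · simp [genFun]
  · rw [sum_coeff_charTerm, genFun, coeff_mk, if_neg (by omega)]

/-! ### Specialization at `t = 0` and `t = -1` -/

theorem eval_zero_fallingTSubOne (n : ℕ) :
    (fallingTSubOne n).eval 0 = (-1) ^ n * (n.factorial : ℤ) := by
  induction n with
  | zero => simp [fallingTSubOne_zero]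
  | succ n ih =>
    rw [fallingTSubOne_succ, Polynomial.eval_mul, ih, Nat.factorial_succ]
    simp
    ring

theorem eval_neg_one_fallingTSubOne (n : ℕ) :
    (fallingTSubOne n).eval (-1) = (-1) ^ n * ((n + 1).factorial : ℤ) := by
  induction n with
  | zero => simp [fallingTSubOne_zero]
  | succ n ih =>
    rw [fallingTSubOne_succ, Polynomial.eval_mul, ih, Nat.factorial_succ (n + 1)]
    simp
    ring

theorem map_charTerm_zero (n : ℕ) :
    map (Polynomial.evalRingHom (0 : ℤ)) (charTerm (n + 1)) = -genocchiTerm (n + 1) := by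
  have hc : (fallingTSubOne (n + 1) * fallingTSubOne n).eval 0 =
      -((n.factorial : ℤ) * ((n + 1).factorial : ℤ)) := by
    rw [Polynomial.eval_mul, eval_zero_fallingTSubOne, eval_zero_fallingTSubOne]
    have : ((-1 : ℤ) ^ n) * (-1) ^ n = 1 := by rw [← mul_pow]; simp
    linear_combination (-(n.factorial : ℤ) * ((n + 1).factorial : ℤ)) * this
  have hp : ∀ k : ℕ, map (Polynomial.evalRingHom (0 : ℤ))
      (1 - C ((k : Polynomial ℤ) * (Polynomial.X - (k : Polynomial ℤ))) * X) =
        1 + C ((k : ℤ) ^ 2) * X := by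
    intro k
    rw [map_sub, map_one, map_mul, map_X, map_C, sub_eq_add_neg, ← neg_mul, ← map_neg]
    congr 3
    simp
    ring
  rw [charTerm, genocchiTerm, map_mul, map_mul, map_C,
    map_invOfUnit_one _ (constantCoeff_charTerm_denominator _), map_pow, map_X, map_prod,
    Nat.add_sub_cancel, Polynomial.coe_evalRingHom, hc, map_neg, neg_mul, neg_mul]
  simp_rw [hp]

theorem map_charTerm_neg_one (n : ℕ) :
    map (Polynomial.evalRingHom (-1 : ℤ)) (charTerm (n + 1)) = -medianGenocchiTerm (n + 1) := by
  have hc : (fallingTSubOne (n + 1) * fallingTSubOne n).eval (-1) =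
      -(((n + 1).factorial : ℤ) * ((n + 1 + 1).factorial : ℤ)) := by
    rw [Polynomial.eval_mul, eval_neg_one_fallingTSubOne, eval_neg_one_fallingTSubOne]
    have : ((-1 : ℤ) ^ n) * (-1) ^ n = 1 := by rw [← mul_pow]; simp
    linear_combination (-((n + 1).factorial : ℤ) * ((n + 1 + 1).factorial : ℤ)) * this
  have hp : ∀ k : ℕ, map (Polynomial.evalRingHom (-1 : ℤ))
      (1 - C ((k : Polynomial ℤ) * (Polynomial.X - (k : Polynomial ℤ))) * X) =
        1 + C ((k : ℤ) * ((k : ℤ) + 1)) * X := by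
    intro k
    rw [map_sub, map_one, map_mul, map_X, map_C, sub_eq_add_neg, ← neg_mul, ← map_neg]
    congr 3
    simp
    ring
  rw [charTerm, medianGenocchiTerm, map_mul, map_mul, map_C,
    map_invOfUnit_one _ (constantCoeff_charTerm_denominator _), map_pow, map_X, map_prod,
    Nat.add_sub_cancel, Polynomial.coe_evalRingHom, hc, map_neg, neg_mul, neg_mul]
  simp_rw [hp]

/-- Specializing `t` in the generating function of the characteristic polynomials. -/
theorem hasFormalSum_specialize {a : ℤ} {f : ℕ → PowerSeries ℤ} {g : ℕ → ℕ}
    (hf : ∀ n, map (Polynomial.evalRingHom a) (charTerm (n + 1)) = -f (n + 1))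
    (hg : ∀ n, (charPoly (BondLattice (gammaGraph (n + 1)))).eval a = -(g (n + 1) : ℤ)) :
    HasFormalSum (fun n : ℕ => f (n + 1)) (genFun fun n => (g n : ℤ)) := by
  have hcoeff : ∀ n k, coeff n (f (k + 1)) = -(coeff n (charTerm (k + 1))).eval a := by
    intro n k
    have h := congrArg (coeff n) (hf k)
    rw [coeff_map, map_neg, Polynomial.coe_evalRingHom] at h
    rw [h, neg_neg]
  refine hasFormalSum_of_coeff (fun n k h => ?_) fun n => ?_
  · rw [hcoeff, coeff_charTerm_eq_zero (by omega)]
    simp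
  · obtain _ | n := n
    · simp [genFun]
    · simp_rw [hcoeff]
      rw [Finset.sum_neg_distrib, ← Polynomial.eval_finsetSum, sum_coeff_charTerm, hg, neg_neg,
        genFun, coeff_mk, if_neg (by omega)]

end Series

/-! ### Counting injections under signed constraints -/

section Injections

variable {α : Type*} [DecidableEq α]

/-- The sum, over all choices of distinct elements `v_1, v_2, …` of `A`, of the products
`w_1 (v_1) w_2 (v_2) ⋯` for the list `w_1, w_2, …` of weights. -/
def injSum : List (α → ℤ) → Finset α → ℤ
  | [], _ => 1
  | w :: L, A => ∑ v ∈ A, w v * injSum L (A.erase v)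

theorem injSum_perm {L L' : List (α → ℤ)} (h : L.Perm L') (A : Finset α) :
    injSum L A = injSum L' A := by
  induction h generalizing A with
  | nil => rfl
  | cons w _ ih => simp [injSum, ih]
  | swap w w' L =>
    simp only [injSum, Finset.mul_sum]
    rw [Finset.sum_comm' (t' := A) (s' := fun v => A.erase v)
      (by intro x y; simp only [Finset.mem_erase]; tauto)]
    refine Finset.sum_congr rfl fun v _ => Finset.sum_congr rfl fun v' _ => ?_
    rw [Finset.erase_right_comm]
    ring
  | trans _ _ ih ih' => rw [ih, ih']

theorem injSum_append_cons (K L : List (α → ℤ)) (w : α → ℤ) (A : Finset α) :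
    injSum (K ++ w :: L) A = ∑ v ∈ A, w v * injSum (K ++ L) (A.erase v) :=
  injSum_perm List.perm_middle A

theorem injSum_append_indicator_cons (K L : List (α → ℤ)) (p : α → Prop) [DecidablePred p]
    (A : Finset α) :
    injSum (K ++ (fun v => if p v then 1 else 0) :: L) A =
      ∑ v ∈ A with p v, injSum (K ++ L) (A.erase v) := by
  rw [injSum_append_cons, Finset.sum_filter]
  exact Finset.sum_congr rfl fun v _ => by split <;> simp

/-- The weight of a negated condition is the constant weight `1` minus that of the condition. -/
theorem injSum_append_not_indicator_cons (K L : List (α → ℤ)) (p : α → Prop) [DecidablePred p]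
    (A : Finset α) :
    injSum (K ++ (fun v => if ¬ p v then 1 else 0) :: L) A =
      injSum (K ++ (fun _ => 1) :: L) A -
        injSum (K ++ (fun v => if p v then 1 else 0) :: L) A := by
  simp only [injSum_append_cons, ← Finset.sum_sub_distrib]
  exact Finset.sum_congr rfl fun v _ => by split <;> simp_all

theorem injSum_replicate_one (f : ℕ) {A : Finset α} (hA : A.card = f) :
    injSum (List.replicate f fun _ => 1) A = f.factorial := by
  induction f generalizing A with
  | zero => simp [injSum]
  | succ f ih =>
    rw [List.replicate_succ, injSum, Finset.sum_congr rfl fun v hv => by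
      rw [ih (by rw [Finset.card_erase_of_mem hv, hA, Nat.add_sub_cancel])]]
    simp [hA, Nat.factorial_succ]

/-- For weights that are indicator functions, `injSum` counts injections. -/
theorem injSum_indicators [Fintype α] {n : ℕ} (R : Fin n → α → Prop) [∀ i, DecidablePred (R i)]
    (A : Finset α) :
    injSum (List.ofFn fun i v => if R i v then 1 else 0) A =
      Nat.card {g : Fin n → α // Function.Injective g ∧ (∀ i, g i ∈ A) ∧ ∀ i, R i (g i)} := by
  induction n generalizing A with
  | zero =>
    have : Unique {g : Fin 0 → α // Function.Injective g ∧ (∀ i, g i ∈ A) ∧ ∀ i, R i (g i)} :=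
      { default := ⟨Fin.elim0, fun i => i.elim0, fun i => i.elim0, fun i => i.elim0⟩
        uniq := fun g => Subtype.ext (Subsingleton.elim _ _) }
    rw [Nat.card_unique]
    simp [injSum]
  | succ n ih =>
    have e : {g : Fin (n + 1) → α // Function.Injective g ∧ (∀ i, g i ∈ A) ∧ ∀ i, R i (g i)} ≃
        Σ v : {v // v ∈ A.filter (R 0)}, {g : Fin n → α // Function.Injective g ∧
          (∀ i, g i ∈ A.erase v) ∧ ∀ i, R i.succ (g i)} :=
      { toFun := fun g => ⟨⟨g.1 0, Finset.mem_filter.2 ⟨g.2.2.1 0, g.2.2.2 0⟩⟩,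
          ⟨fun i => g.1 i.succ, fun i j h => Fin.succ_injective _ (g.2.1 h),
            fun i => Finset.mem_erase.2 ⟨fun h => Fin.succ_ne_zero i (g.2.1 h), g.2.2.1 _⟩,
            fun i => g.2.2.2 _⟩⟩
        invFun := fun x => ⟨Fin.cons x.1.1 x.2.1,
          Fin.cons_injective_iff.2 ⟨fun ⟨i, hi⟩ => (Finset.mem_erase.1 (x.2.2.2.1 i)).1 hi, x.2.2.1⟩,
          Fin.cases (Finset.mem_filter.1 x.1.2).1 fun i => (Finset.mem_erase.1 (x.2.2.2.1 i)).2,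
          Fin.cases (Finset.mem_filter.1 x.1.2).2 fun i => x.2.2.2.2 i⟩
        left_inv := fun g => by
          apply Subtype.ext
          funext i
          induction i using Fin.cases <;> rfl
        right_inv := fun x => rfl }
    have h := injSum_append_indicator_cons [] (List.ofFn fun (i : Fin n) v =>
      if R i.succ v then (1 : ℤ) else 0) (R 0) A
    rw [List.ofFn_succ, Nat.card_congr e, Nat.card_sigma]
    push_cast
    simp_rw [← ih]
    rw [Finset.sum_coe_sort (A.filter (R 0)) fun v => injSum (List.ofFn fun (i : Fin n) v =>
      if R i.succ v then (1 : ℤ) else 0) (A.erase v)]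
    exact h

end Injections

/-! ### Dumont permutations -/

section Dumont

/-- The constraint on the value `v` of a permutation at `p`: `v < p` if `p` is even, and
`v ≥ p + δ` (in negated form) if `p` is odd. For `δ = 0` these are the Dumont permutations, for `δ = 1` those
without fixed points. -/
def DumontRel (δ p v : ℕ) : Prop := if Even p then v < p else ¬ v < p + δ

instance (δ p v : ℕ) : Decidable (DumontRel δ p v) := by unfold DumontRel; infer_instance

/-- The number of ways to fill the last `2m` positions, starting with an odd one, and `u` further
positions without constraint, when `u` of the available values lie below the first of the
`2m`. -/
def gandhi (δ : ℕ) : ℕ → ℕ → ℤ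
  | 0, u => u.factorial
  | m + 1, u => (u + 1) * gandhi δ m (u + 1) - u * (u + δ) * gandhi δ m u

theorem card_filter_lt_erase {T : Finset ℕ} (A : Finset T) {v : T} (hv : v ∈ A) {p : ℕ}
    (hp : v.1 < p) :
    ((A.erase v).filter fun x : T => x.1 < p).card =
      (A.filter fun x : T => x.1 < p).card - 1 := by
  rw [Finset.filter_erase, Finset.card_erase_of_mem (Finset.mem_filter.2 ⟨hv, hp⟩)]

/-- The constraint of an odd position is the difference of no constraint, in which case the position
is postponed, and the opposite constraint, which asks for a small value, like the constraint of an
even position. A small value satisfies the later upper bounds as well, so removing any one of them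
has the same effect on the numbers `hA'` of values below the later thresholds. -/
theorem injSum_dumont {T : Finset ℕ} {δ : ℕ} (hδ : δ ≤ 1) (m s f : ℕ) (hs : Odd s) (A : Finset T)
    (hA : A.card = f + 2 * m)
    (hA' : ∀ r ≤ 2 * m, (A.filter fun x : T => x.1 < s + r).card = f + r) :
    injSum (List.replicate f (fun _ => 1) ++ (List.range' s (2 * m)).map
      fun p (v : T) => if DumontRel δ p v then 1 else 0) A = gandhi δ m f := by
  induction m generalizing s f A with
  | zero =>
    rw [gandhi, Nat.mul_zero, List.range'_zero, List.map_nil, List.append_nil,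
      injSum_replicate_one f (by omega)]
  | succ m ih =>
    have hodd : (fun v : T => if DumontRel δ s v then (1 : ℤ) else 0) =
        fun v => if ¬ v.1 < s + δ then 1 else 0 := by
      funext v
      simp only [DumontRel, Nat.not_even_iff_odd.2 hs, if_false]
    have heven : (fun v : T => if DumontRel δ (s + 1) v then (1 : ℤ) else 0) =
        fun v => if v.1 < s + 1 then 1 else 0 := by
      funext v
      simp only [DumontRel, hs.add_one, if_true]
    rw [show 2 * (m + 1) = 2 * m + 1 + 1 by ring, List.range'_succ, List.range'_succ, List.map_cons,
      List.map_cons, hodd, heven, injSum_append_not_indicator_cons, gandhi]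
    congr 1
    · -- the odd position is unconstrained
      rw [List.append_cons, ← List.replicate_succ', injSum_append_indicator_cons,
        Finset.sum_congr rfl fun v hv => ih (s + 1 + 1) (f + 1) (by
          rw [add_assoc]; exact hs.add_even (by decide)) (A.erase v) ?_ ?_, Finset.sum_const,
        hA' 1 (by omega)]
      · simp
      · rw [Finset.card_erase_of_mem (Finset.mem_filter.1 hv).1, hA]
        omega
      · intro r hr
        have hv' := Finset.mem_filter.1 hv
        rw [card_filter_lt_erase A hv'.1 (by omega), show s + 1 + 1 + r = s + (r + 2) by ring,
          hA' _ (by omega)]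
        omega
    · -- the odd position has a value below `s + δ`
      have h : ∀ v ∈ A.filter (fun v : T => v.1 < s + δ),
          ∀ v' ∈ (A.erase v).filter (fun v : T => v.1 < s + 1),
          injSum (List.replicate f (fun _ => 1) ++ (List.range' (s + 1 + 1) (2 * m)).map
            fun p (v : T) => if DumontRel δ p v then 1 else 0) ((A.erase v).erase v') =
              gandhi δ m f := by
        intro v hv v' hv'
        have hv1 := Finset.mem_filter.1 hv
        have hv2 := Finset.mem_filter.1 hv'
        refine ih (s + 1 + 1) f (by rw [add_assoc]; exact hs.add_even (by decide)) _ ?_ ?_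
        · rw [Finset.card_erase_of_mem hv2.1, Finset.card_erase_of_mem hv1.1, hA]
          omega
        · intro r hr
          rw [card_filter_lt_erase _ hv2.1 (by omega), card_filter_lt_erase A hv1.1 (by omega),
            show s + 1 + 1 + r = s + (r + 2) by ring, hA' _ (by omega)]
          omega
      rw [injSum_append_indicator_cons, Finset.sum_congr rfl fun v hv => by
        rw [injSum_append_indicator_cons, Finset.sum_congr rfl (h v hv),
          Finset.sum_const, card_filter_lt_erase A (Finset.mem_filter.1 hv).1
            (by have := (Finset.mem_filter.1 hv).2; omega), hA' 1 (by omega)],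
        Finset.sum_const, hA' δ (by omega)]
      simp
      ring

/-- The positions `1, …, N`, numbered from `0`. -/
def positionEquiv (N : ℕ) : Fin N ≃ Finset.Icc 1 N where
  toFun i := ⟨1 + i, by have := i.2; simp only [Finset.mem_Icc]; omega⟩
  invFun p := ⟨p.1 - 1, by have := Finset.mem_Icc.1 p.2; omega⟩
  left_inv i := by simp
  right_inv p := Subtype.ext (by have := Finset.mem_Icc.1 p.2; simp only; omega)

theorem card_perm_dumontRel {δ : ℕ} (hδ : δ ≤ 1) (m : ℕ) :
    (Nat.card {σ : Equiv.Perm (Finset.Icc 1 (2 * m)) // ∀ p, DumontRel δ p.1 (σ p).1} : ℤ) =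
      gandhi δ m 0 := by
  have hcard : ∀ r ≤ 2 * m,
      ((Finset.univ : Finset (Finset.Icc 1 (2 * m))).filter fun x => x.1 < 1 + r).card = r := by
    intro r hr
    have h : ((Finset.univ : Finset (Finset.Icc 1 (2 * m))).filter fun x => x.1 < 1 + r).map
        (Function.Embedding.subtype _) = Finset.Icc 1 r := by
      ext x
      simp only [Finset.mem_map, Finset.mem_filter, Finset.mem_univ, true_and,
        Function.Embedding.subtype_apply, Subtype.exists, Finset.mem_Icc]
      constructor
      · rintro ⟨y, hy, h, rfl⟩
        omega
      · exact fun h => ⟨x, by omega, by omega, rfl⟩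
    rw [← Finset.card_map, h, Nat.card_Icc, Nat.add_sub_cancel]
  rw [← injSum_dumont hδ m 1 0 odd_one (Finset.univ : Finset (Finset.Icc 1 (2 * m))) (by simp)
    fun r hr => by rw [hcard r hr, zero_add], List.replicate_zero, List.nil_append,
    show (List.range' 1 (2 * m)).map (fun p (v : Finset.Icc 1 (2 * m)) =>
      if DumontRel δ p v then (1 : ℤ) else 0) = List.ofFn fun (i : Fin (2 * m)) v =>
        if DumontRel δ (positionEquiv _ i).1 v.1 then (1 : ℤ) else 0 from
      List.ext_getElem (by simp) fun i h1 h2 => by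
        simp [positionEquiv]
        rfl,
    injSum_indicators (fun (i : Fin (2 * m)) (v : Finset.Icc 1 (2 * m)) => DumontRel δ (positionEquiv _ i).1 v.1)]
  congr 1
  let ε := positionEquiv (2 * m)
  exact Nat.card_congr
    { toFun := fun σ => ⟨σ.1 ∘ ε, σ.1.injective.comp ε.injective, fun _ => Finset.mem_univ _,
        fun i => σ.2 _⟩
      invFun := fun g => ⟨Equiv.ofBijective (g.1 ∘ ε.symm)
          (Finite.injective_iff_bijective.1 (g.2.1.comp ε.symm.injective)), fun p => by
        simpa [ε] using g.2.2.2 (ε.symm p)⟩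
      left_inv := fun σ => by
        apply Subtype.ext
        ext p
        simp
      right_inv := fun g => by
        apply Subtype.ext
        funext i
        simp }

theorem isDumont_iff {m : ℕ} (σ : Equiv.Perm (Finset.Icc 1 (2 * m))) :
    IsDumont σ ↔ ∀ p, DumontRel 0 p.1 (σ p).1 := by
  refine forall_congr' fun p => ?_
  rw [← Subtype.coe_lt_coe, ← Subtype.coe_le_coe, DumontRel, ← Nat.not_even_iff_odd]
  split <;> simp_all

theorem isDumont_derangement_iff {m : ℕ} (σ : Equiv.Perm (Finset.Icc 1 (2 * m))) :
    (IsDumont σ ∧ ∀ i, σ i ≠ i) ↔ ∀ p, DumontRel 1 p.1 (σ p).1 := by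
  rw [IsDumont, ← forall_and]
  refine forall_congr' fun p => ?_
  rw [← Subtype.coe_lt_coe, ← Subtype.coe_le_coe, DumontRel, ← Nat.not_even_iff_odd, Ne,
    Subtype.ext_iff]
  by_cases h : Even p.1 <;> simp only [h, if_true, if_false, not_true, not_false_iff,
    forall_const, IsEmpty.forall_iff, and_true, true_and] <;> omega

theorem genocchi_succ (n : ℕ) : (genocchi (n + 1) : ℤ) = gandhi 0 n 0 := by
  rw [← card_perm_dumontRel (by omega), genocchi, Nat.add_sub_cancel]
  simp_rw [isDumont_iff]

theorem medianGenocchi_eq (n : ℕ) : (medianGenocchi n : ℤ) = gandhi 1 (n + 1) 0 := by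
  rw [← card_perm_dumontRel le_rfl, medianGenocchi]
  simp_rw [isDumont_derangement_iff]

/-! ### Dumont permutations and colourings of `Γ` -/

theorem mul_gandhi_zero (n k : ℕ) :
    (k : ℤ) * gandhi 0 n k = k.factorial * extensionCount (0 : ℤ) (n + 1) k := by
  induction n generalizing k with
  | zero =>
    simp only [gandhi, extensionCount]
    ring
  | succ n ih =>
    have h1 := ih (k + 1)
    rw [Nat.factorial_succ] at h1
    rw [gandhi, extensionCount]
    push_cast at h1 ⊢
    linear_combination (k : ℤ) * h1 - (k : ℤ) ^ 2 * ih k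

theorem gandhi_zero_zero (n : ℕ) : gandhi 0 n 0 = extensionCount (0 : ℤ) n 1 := by
  obtain _ | n := n
  · simp [gandhi, extensionCount]
  · simpa [gandhi] using mul_gandhi_zero n 1

theorem gandhi_one_succ (n k : ℕ) :
    gandhi 1 (n + 1) k = (k + 1).factorial * extensionCount (-1 : ℤ) n k := by
  induction n generalizing k with
  | zero =>
    simp only [gandhi, extensionCount, Nat.factorial_succ]
    push_cast
    ring
  | succ n ih =>
    rw [gandhi, ih, ih, extensionCount, Nat.factorial_succ (k + 1)]
    push_cast
    ring

theorem eval_zero_charPoly_gammaGraph (n : ℕ) :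
    (charPoly (BondLattice (gammaGraph (n + 1)))).eval 0 = -(genocchi (n + 1) : ℤ) := by
  have h := map_extensionCount (Polynomial.evalRingHom (0 : ℤ)) Polynomial.X n 1
  simp only [Polynomial.coe_evalRingHom, Polynomial.eval_X] at h
  rw [charPoly_gammaGraph, genocchi_succ, gandhi_zero_zero, Polynomial.eval_mul, h]
  simp

theorem eval_neg_one_charPoly_gammaGraph (n : ℕ) :
    (charPoly (BondLattice (gammaGraph (n + 1)))).eval (-1) = -(medianGenocchi (n + 1) : ℤ) := by
  have h := map_extensionCount (Polynomial.evalRingHom (-1 : ℤ)) Polynomial.X n 1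
  simp only [Polynomial.coe_evalRingHom, Polynomial.eval_X] at h
  rw [charPoly_gammaGraph, medianGenocchi_eq, gandhi_one_succ, extensionCount,
    Polynomial.eval_mul, h]
  simp

end Dumont

/-! ### The generating functions and their specializations -/

theorem theorem5p6 :
    -- the generating function of the characteristic polynomials of the intersection lattices
    HasFormalSum (fun n : ℕ => charTerm (n + 1))
      (genFun fun n => charPoly (homogenizedLinial n).IntersectionPoset) ∧
    -- the same for the bond lattices of the graphs `Γ_{2n}`
    HasFormalSum (fun n : ℕ => charTerm (n + 1))
      (genFun fun n => charPoly (BondLattice (gammaGraph n))) ∧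
    -- at `t = 0`, up to a common sign, both sides reduce to those of the formula for `g_n`
    ((∀ n : ℕ, 1 ≤ n →
        (charPoly (homogenizedLinial n).IntersectionPoset).eval 0 = -(genocchi n : ℤ) ∧
        PowerSeries.map (Polynomial.evalRingHom (0 : ℤ)) (charTerm n) = -genocchiTerm n) ∧
      HasFormalSum (fun n : ℕ => genocchiTerm (n + 1)) (genFun fun n => (genocchi n : ℤ))) ∧
    -- at `t = -1`, up to a common sign, both sides reduce to those of the formula for `h_n`
    ((∀ n : ℕ, 1 ≤ n →
        (charPoly (homogenizedLinial n).IntersectionPoset).eval (-1) = -(medianGenocchi n : ℤ) ∧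
        PowerSeries.map (Polynomial.evalRingHom (-1 : ℤ)) (charTerm n) = -medianGenocchiTerm n) ∧
      HasFormalSum (fun n : ℕ => medianGenocchiTerm (n + 1))
        (genFun fun n => (medianGenocchi n : ℤ))) := by
  simp only [charPoly_homogenizedLinial]
  refine ⟨hasFormalSum_charTerm, hasFormalSum_charTerm, ⟨fun n hn => ?_, ?_⟩, fun n hn => ?_, ?_⟩
  · obtain ⟨n, rfl⟩ := Nat.exists_eq_add_of_le' hn
    exact ⟨eval_zero_charPoly_gammaGraph n, map_charTerm_zero n⟩
  · exact hasFormalSum_specialize map_charTerm_zero eval_zero_charPoly_gammaGraph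
  · obtain ⟨n, rfl⟩ := Nat.exists_eq_add_of_le' hn
    exact ⟨eval_neg_one_charPoly_gammaGraph n, map_charTerm_neg_one n⟩
  · exact hasFormalSum_specialize map_charTerm_neg_one eval_neg_one_charPoly_gammaGraph
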